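/- **Definitions.** A labeled transition system (LTS) over a set of atoms has states, a set of initial states, labeled transitions, and a finite set of atoms labeling each state. $\mathrm{CTL}^*\backslash X$ is $\mathrm{CTL}^*$ without the next-operator; its path quantifiers range over the infinite paths that start in the given state, and $M\models\varphi$ means that every initial state of $M$ satisfies the state formula $\varphi$. For $d\in\mathbb N$, $d\text{-}\mathrm{CTL}^*\backslash X$ is the fragment of formulas whose path quantifiers are nested to depth at most $d$. Write $M\equiv_{d\text{-}\mathrm{CTL}^*\backslash X}N$ if $M$ and $N$ satisfy the same formulas of this fragment. A *topology* $G=(V,E,x)$ is a finite directed graph with $V=\{1,\dots,n\}$, $n\ge 1$, no self-loops, and an initial vertex $x\in V$. For a $k$-tuple $\bar g=(g_1,\dots,g_k)$ of distinct vertices, the *graph LTS* $G|\bar g$ has state set $V$, initial state $x$, transitions $E$ (all with the same action label), and labels $v$ with $\{i\}$ if $v=g_i$ and with $\emptyset$ if $v\notin\bar g$. Let $\Sigma_{\mathrm{int}}$ be a finite nonempty set of internal labels. A *direction-unaware process template* $P$ is an LTS with transition labels $\Sigma_{\mathrm{int}}\sqcup\{\mathsf{snd},\mathsf{rcv}\}$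 and a finite state set $Q=T\sqcup N$ (states in $T$ have the token, states in $N$ do not) such that: the initial states are some $\iota_t\in T$ and $\iota_n\in N$; $\mathsf{snd}$-transitions go from $T$ to $N$, $\mathsf{rcv}$-transitions from $N$ to $T$, and internal transitions preserve $T$ and $N$; every state has an outgoing transition; and the label sequence of every infinite path, from any state, lies in $(\Sigma_{\mathrm{int}}^*\,\mathsf{snd}\,\Sigma_{\mathrm{int}}^*\,\mathsf{rcv})^\omega\cup(\Sigma_{\mathrm{int}}^*\,\mathsf{rcv}\,\Sigma_{\mathrm{int}}^*\,\mathsf{snd})^\omega$. The *token-passing system* $P^G$ has state set $Q^V$; its initial state is the unique $s$ such that every $s(v)$ is an initial state of $P$ and exactly $s(x)$ has the token. In an internal transition one process $v\in V$ makes an internal transition of $P$ and all others stay unchanged; in a token-passing transition, for some edge $(v,w)\in E$, process $v$ makes a $\mathsf{snd}$-transition, process $w$ makes an $\mathsf{rcv}$-transition, and all others stay unchanged. The *projection* $P^G|\bar g$ is this transition system in which $s$ is labeled by the atoms $p@i$ ($1\le i\le k$) such that $p$ is in the label of the local state $s(g_i)$. **Theorem (Reduction).** For all $d,k\in\mathbb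 N$, all topologies $G,G'$, all direction-unaware process templates $P$, and all $k$-tuples $\bar g$ of distinct vertices of $G$ and $\bar g'$ of distinct vertices of $G'$: $$\text{if}\quad G|\bar g\ \equiv_{d\text{-}\mathrm{CTL}^*\backslash X}\ G'|\bar g'\quad\text{then}\quad P^G|\bar g\ \equiv_{d\text{-}\mathrm{CTL}^*\backslash X}\ P^{G'}|\bar g'.$$ -/

import Mathlib

namespace TokenPassing

open scoped Computability

universe u

/-! ### Labeled transition systems -/

/-- A labeled transition system over the atoms `AP`, with states `Q` and action labels `A`. -/
structure LTS (AP Q A : Type*) where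
  init : Set Q
  trans : Q → A → Q → Prop
  label : Q → Set AP
  label_finite : ∀ q, (label q).Finite

namespace LTS

variable {AP Q A : Type*}

/-- `q 0, a 0, q 1, a 1, …` is an infinite state-action path (starting in an arbitrary state). -/
def IsInfStateActionPath (M : LTS AP Q A) (q : ℕ → Q) (a : ℕ → A) : Prop :=
  ∀ i, M.trans (q i) (a i) (q (i + 1))

/-- Infinite paths: projections of infinite state-action paths to the states. -/
def IsInfPath (M : LTS AP Q A) (q : ℕ → Q) : Prop :=
  ∃ a : ℕ → A, M.IsInfStateActionPath q a

/-- Infinite action-labeled paths: projections of infinite state-action paths to the actions. -/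
def IsInfActionPath (M : LTS AP Q A) (a : ℕ → A) : Prop :=
  ∃ q : ℕ → Q, M.IsInfStateActionPath q a

end LTS

/-! ### The logic CTL* without the next-operator -/

mutual
/-- State formulas of CTL*\X. -/
inductive StateFormula (AP : Type u) : Type u
  | tt : StateFormula AP
  | atom : AP → StateFormula AP
  | not : StateFormula AP → StateFormula AP
  | and : StateFormula AP → StateFormula AP → StateFormula AP
  /-- the path quantifier `E`; the quantifier `A` is `¬ E ¬` -/
  | ex : PathFormula AP → StateFormula AP
/-- Path formulas of CTL*\X. -/
inductive PathFormula (AP : Type u) : Type u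
  | state : StateFormula AP → PathFormula AP
  | not : PathFormula AP → PathFormula AP
  | and : PathFormula AP → PathFormula AP → PathFormula AP
  | until : PathFormula AP → PathFormula AP → PathFormula AP
end

mutual
/-- Nesting depth of path quantifiers in a state formula. -/
def StateFormula.depth {AP : Type u} : StateFormula AP → ℕ
  | .tt => 0
  | .atom _ => 0
  | .not φ => φ.depth
  | .and φ ψ => max φ.depth ψ.depth
  | .ex φ => φ.depth + 1
/-- Nesting depth of path quantifiers in a path formula. -/
def PathFormula.depth {AP : Type u} : PathFormula AP → ℕ
  | .state φ => φ.depth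
  | .not φ => φ.depth
  | .and φ ψ => max φ.depth ψ.depth
  | .until φ ψ => max φ.depth ψ.depth
end

mutual
/-- `φ.Sat M q`: the state `q` of `M` satisfies the state formula `φ`. Path quantifiers range over
the infinite paths that start in the given state. -/
def StateFormula.Sat {AP : Type u} {Q A : Type*} (M : LTS AP Q A) : StateFormula AP → Q → Prop
  | .tt, _ => True
  | .atom p, q => p ∈ M.label q
  | .not φ, q => ¬ φ.Sat M q
  | .and φ ψ, q => φ.Sat M q ∧ ψ.Sat M q
  | .ex φ, q => ∃ π : ℕ → Q, M.IsInfPath π ∧ π 0 = q ∧ φ.Sat M π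
/-- `φ.Sat M π`: the state sequence `π` of `M` satisfies the path formula `φ`. -/
def PathFormula.Sat {AP : Type u} {Q A : Type*} (M : LTS AP Q A) : PathFormula AP → (ℕ → Q) → Prop
  | .state φ, π => φ.Sat M (π 0)
  | .not φ, π => ¬ φ.Sat M π
  | .and φ ψ, π => φ.Sat M π ∧ ψ.Sat M π
  | .until φ ψ, π =>
      ∃ j, ψ.Sat M (fun m => π (j + m)) ∧ ∀ i < j, φ.Sat M (fun m => π (i + m))
end

/-- `M ⊨ φ`: every initial state of `M` satisfies `φ`. -/
def LTS.Models {AP Q A : Type*} (M : LTS AP Q A) (φ : StateFormula AP) : Prop :=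
  ∀ q ∈ M.init, φ.Sat M q

/-- `M ≡ N` with respect to `d`-CTL*\X: the two systems satisfy the same formulas of CTL*\X whose
path quantifiers are nested to depth at most `d`. -/
def DepthEquiv (d : ℕ) {AP Q A Q' A' : Type*} (M : LTS AP Q A) (N : LTS AP Q' A') : Prop :=
  ∀ φ : StateFormula AP, φ.depth ≤ d → (M.Models φ ↔ N.Models φ)

/-! ### Direction-unaware templates -/

/-- Action labels of a template: internal labels from `I`, and the two symbols `snd`, `rcv`. -/
inductive TemplateAct (I : Type*) : Type _
  | int : I → TemplateAct I
  | snd : TemplateAct I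
  | rcv : TemplateAct I

/-- One-letter words consisting of an internal label. -/
def intLetters (I : Type*) : Language (TemplateAct I) :=
  {w | ∃ a : I, w = [TemplateAct.int a]}

/-- The `ω`-power of a language: the infinite concatenations of its nonempty words. -/
def omegaPower {α : Type*} (L : Language α) : Set (ℕ → α) :=
  {w | ∃ n : ℕ → ℕ, n 0 = 0 ∧ StrictMono n ∧
    ∀ i, (List.range' (n i) (n (i + 1) - n i)).map w ∈ L}

/-- `(int* snd int* rcv)^ω`. -/
def sndRcvWords (I : Type*) : Set (ℕ → TemplateAct I) :=
  omegaPower ((intLetters I)∗ * {[TemplateAct.snd]} * (intLetters I)∗ * {[TemplateAct.rcv]})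

/-- `(int* rcv int* snd)^ω`. -/
def rcvSndWords (I : Type*) : Set (ℕ → TemplateAct I) :=
  omegaPower ((intLetters I)∗ * {[TemplateAct.rcv]} * (intLetters I)∗ * {[TemplateAct.snd]})

/-- A direction-unaware template over the local atoms `AP`, with local states `Q` and internal
labels `I`. The states in `hasTok` have the token, those in its complement do not; both sets are
nonempty because of `initTok` and `initNoTok`. -/
structure Template (AP Q I : Type*) extends LTS AP Q (TemplateAct I) where
  finite_states : Finite Q
  hasTok : Set Q
  initTok : Q
  initNoTok : Q
  initTok_mem : initTok ∈ hasTok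
  initNoTok_notMem : initNoTok ∉ hasTok
  init_eq : init = {initTok, initNoTok}
  snd_tok : ∀ q q', trans q .snd q' → q ∈ hasTok ∧ q' ∉ hasTok
  rcv_tok : ∀ q q', trans q .rcv q' → q ∉ hasTok ∧ q' ∈ hasTok
  int_tok : ∀ q a q', trans q (.int a) q' → (q ∈ hasTok ↔ q' ∈ hasTok)
  total : ∀ q, ∃ a q', trans q a q'
  alternate : ∀ a : ℕ → TemplateAct I,
    toLTS.IsInfActionPath a → a ∈ sndRcvWords I ∪ rcvSndWords I

/-! ### Topologies and their graph systems -/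

/-- A topology: a finite directed graph without self-loops, with an initial vertex. -/
structure Topology where
  size : ℕ
  edge : Fin size → Fin size → Prop
  irrefl : ∀ v, ¬ edge v v
  start : Fin size

/-- The vertices (process indices) of a topology. -/
abbrev Topology.Vertex (G : Topology) : Type := Fin G.size

/-- The graph LTS of `G` and `g`: its states are the vertices of `G`, its transitions the edges
(with a single action label), and the vertex `g i` is labeled by the position `i`. -/
def graphLTS (G : Topology) {k : ℕ} (g : Fin k → G.Vertex) : LTS (Fin k) G.Vertex Unit where
  init := {G.start}
  trans v _ w := G.edge v w
  label v := {i | v = g i}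
  label_finite _ := Set.toFinite _

/-! ### Token-passing systems and their projections -/

/-- Action labels of a token-passing system: internal labels from `I`, and `tok`. -/
inductive SystemAct (I : Type*) : Type _
  | int : I → SystemAct I
  | tok : SystemAct I

/-- The token-passing system of the template `P` on the topology `G`. -/
def tokenSystem {AP Q I : Type*} (P : Template AP Q I) (G : Topology) :
    LTS (AP × G.Vertex) (G.Vertex → Q) (SystemAct I) where
  init := {s | (∀ v, s v ∈ P.init) ∧ ∀ v, s v ∈ P.hasTok ↔ v = G.start}
  trans
    | s, .int a, s' => ∃ v, P.trans (s v) (.int a) (s' v) ∧ ∀ w, w ≠ v → s w = s' w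
    | s, .tok, s' => ∃ v w, G.edge v w ∧ P.trans (s v) .snd (s' v) ∧ P.trans (s w) .rcv (s' w) ∧
        ∀ u, u ≠ v → u ≠ w → s' u = s u
  label s := {x | x.1 ∈ P.label (s x.2)}
  label_finite s := by
    have h : {x : AP × G.Vertex | x.1 ∈ P.label (s x.2)} =
        ⋃ v, (fun p => (p, v)) '' P.label (s v) := by
      ext ⟨p, v⟩
      simp
    rw [h]
    exact Set.finite_iUnion fun v => (P.label_finite (s v)).image _

/-- The projection of the token-passing system of `P` and `G` onto the tuple `g`: the same
transition system, labeled by the atoms `(p, i)`, read `p@i`, such that the atom `p` with index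
`g i` holds. -/
def projection {AP Q I : Type*} (P : Template AP Q I) (G : Topology) {k : ℕ}
    (g : Fin k → G.Vertex) : LTS (AP × Fin k) (G.Vertex → Q) (SystemAct I) where
  init := (tokenSystem P G).init
  trans := (tokenSystem P G).trans
  label s := {x | (x.1, g x.2) ∈ (tokenSystem P G).label s}
  label_finite s := by
    have h : {x : AP × Fin k | (x.1, g x.2) ∈ (tokenSystem P G).label s} =
        ⋃ i, (fun p => (p, i)) '' P.label (s (g i)) := by
      ext ⟨p, i⟩
      simp [tokenSystem]
    rw [h]
    exact Set.finite_iUnion fun i => (P.label_finite (s (g i))).image _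

end TokenPassing

open TokenPassing

-- Only the token and the observed processes matter. In any run on `G` the token moves infinitely
-- often, because a template has no infinite internal run; its positions therefore form an infinite
-- path of the graph. If the token holders have the same graph type of depth `d + 1`, this path is
-- matched, up to stuttering and in types of depth `d`, by a path of `G'`
-- (`exists_stutterMatch_of_stateType_eq`). The run is then replayed on `G'` along that path
-- (`SystemRel.exists_path`). Internal moves of observed processes are copied and those of
-- unobserved ones dropped, while unobserved processes in `G'` run internally until they can send or
-- receive.
--
-- Stuttering is harmless: since there are no self-loops and the tuple is injective, adjacent
-- vertices of equal type are both unobserved, so the extra or missing token moves leave the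
-- observed states alone. The relation "same holder type, same observed states" is thus a stutter
-- bisimulation graded by depth (`stutterBisim_projection`), and such relations preserve formulas
-- (`StateFormula.sat_iff_of_bisim`).

namespace TokenPassing

open Relation

-- Stuttering matches of sequences

section StutterMatching

variable {Q Q' : Type*}

/-- The sequence `π'` splits into consecutive (possibly empty) blocks, the `i`-th of which starts at
position `j i` and is related to the single state `π i`. -/
def StutterMatch (R : Q → Q' → Prop) (π : ℕ → Q) (π' : ℕ → Q') : Prop :=
  ∃ j : ℕ → ℕ, j 0 = 0 ∧ Monotone j ∧ (∀ n, ∃ i, n ≤ j i) ∧ (∀ i, R (π i) (π' (j i))) ∧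
    ∀ i m, j i ≤ m → m < j (i + 1) → R (π i) (π' m)

/-- An empty block also carries the relation at its starting position, so block `0` may be empty. -/
theorem StutterMatch.head {R : Q → Q' → Prop} {π : ℕ → Q} {π' : ℕ → Q'}
    (h : StutterMatch R π π') : R (π 0) (π' 0) := by
  obtain ⟨j, h0, -, -, h1, -⟩ := h
  simpa [h0] using h1 0

/-- Suffixes starting at related positions match again. -/
theorem stutterMatch_suffix {R : Q → Q' → Prop} {π : ℕ → Q} {π' : ℕ → Q'} {j : ℕ → ℕ}
    (hmono : Monotone j) (hunb : ∀ n, ∃ i, n ≤ j i) (hR : ∀ i, R (π i) (π' (j i)))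
    (hblock : ∀ i m, j i ≤ m → m < j (i + 1) → R (π i) (π' m)) {i m : ℕ} (him : j i ≤ m)
    (hm : m = j i ∨ m < j (i + 1)) :
    StutterMatch R (fun t => π (i + t)) (fun t => π' (m + t)) := by
  have hlt : ∀ r, 1 ≤ r → m ≤ j (i + r) := fun r hr => by
    have := hmono (show i + 1 ≤ i + r by omega)
    have := hmono (show i ≤ i + 1 by omega)
    omega
  refine ⟨fun r => j (i + r) - m, Nat.sub_eq_zero_of_le him, fun a b hab => ?_, fun n => ?_, fun r => ?_,
    fun r t h1 h2 => ?_⟩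
  · exact Nat.sub_le_sub_right (hmono (by omega)) m
  · obtain ⟨r, hr⟩ := hunb (n + m)
    refine ⟨r, ?_⟩
    have := hmono (show r ≤ i + r by omega)
    show n ≤ j (i + r) - m
    omega
  · rcases Nat.eq_zero_or_pos r with rfl | hr
    · have h0 : m + (j (i + 0) - m) = m := by rw [add_zero]; omega
      show R (π (i + 0)) (π' (m + (j (i + 0) - m)))
      rw [h0]
      rcases hm with h | h
      · rw [h]; exact hR i
      · exact hblock i m him h
    · have h0 : m + (j (i + r) - m) = j (i + r) := by have := hlt r hr; omega
      show R (π (i + r)) (π' (m + (j (i + r) - m)))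
      rw [h0]; exact hR _
  · have h2' : t < j (i + (r + 1)) - m := h2
    have h1' : j (i + r) - m ≤ t := h1
    exact hblock (i + r) (m + t) (by omega) (by rw [add_assoc]; omega)

/-- Every position of `π'` belongs to a block that is preceded only by blocks starting strictly
earlier. -/
theorem exists_first_block {j : ℕ → ℕ} (h0 : j 0 = 0)
    (hunb : ∀ n, ∃ i, n ≤ j i) (m : ℕ) :
    ∃ i, j i ≤ m ∧ (m = j i ∨ m < j (i + 1)) ∧ ∀ i' < i, j i' < m := by
  classical
  let i := Nat.find (hunb m)
  have hi : m ≤ j i := Nat.find_spec (hunb m)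
  have hlt : ∀ i' < i, j i' < m := fun i' h => not_le.1 (Nat.find_min (hunb m) h)
  -- If the first block starting at or after `m` starts later than `m`, then `m` lies inside the
  -- preceding block.
  rcases hi.eq_or_lt with h | h
  · exact ⟨i, h.ge, Or.inl h, hlt⟩
  · have hpos : i ≠ 0 := fun h' => by rw [h', h0] at h; omega
    refine ⟨i - 1, (hlt _ (by omega)).le, Or.inr ?_, fun i' h' => hlt _ (by omega)⟩
    rwa [Nat.sub_add_cancel (by omega)]

/-- A position before the start of block `i` lies in an earlier block. -/
theorem exists_block_of_lt {j : ℕ → ℕ} (h0 : j 0 = 0) {i m : ℕ} (hm : m < j i) :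
    ∃ l < i, j l ≤ m ∧ m < j (l + 1) := by
  induction i with
  | zero => omega
  | succ i ih =>
    by_cases h : m < j i
    · obtain ⟨l, hl, h⟩ := ih h
      exact ⟨l, by omega, h⟩
    · exact ⟨i, by omega, by omega, hm⟩

/-- The until operator cannot tell matching sequences apart. -/
theorem until_iff_of_match {R : Q → Q' → Prop} {F H : (ℕ → Q) → Prop} {F' H' : (ℕ → Q') → Prop}
    (hF : ∀ σ σ', StutterMatch R σ σ' → (F σ ↔ F' σ'))
    (hH : ∀ σ σ', StutterMatch R σ σ' → (H σ ↔ H' σ')) {π : ℕ → Q} {π' : ℕ → Q'}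
    (hm : StutterMatch R π π') :
    (∃ j, H (fun m => π (j + m)) ∧ ∀ i < j, F (fun m => π (i + m))) ↔
      ∃ j, H' (fun m => π' (j + m)) ∧ ∀ i < j, F' (fun m => π' (i + m)) := by
  obtain ⟨j, h0, hmono, hunb, hR, hblock⟩ := hm
  constructor
  · rintro ⟨i, hi, hlt⟩
    refine ⟨j i, (hH _ _ (stutterMatch_suffix hmono hunb hR hblock le_rfl (Or.inl rfl))).1 hi,
      fun m hm => ?_⟩
    obtain ⟨l, hl, h1, h2⟩ := exists_block_of_lt h0 hm
    exact (hF _ _ (stutterMatch_suffix hmono hunb hR hblock h1 (Or.inr h2))).1 (hlt l hl)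
  · rintro ⟨m, hm, hlt⟩
    -- Several blocks may start at `m`; the first choice ensures that every earlier block starts
    -- before `m`, where `F'` is known.
    obtain ⟨i, h1, h2, h3⟩ := exists_first_block h0 hunb m
    refine ⟨i, (hH _ _ (stutterMatch_suffix hmono hunb hR hblock h1 h2)).2 hm, fun l hl => ?_⟩
    exact (hF _ _ (stutterMatch_suffix hmono hunb hR hblock le_rfl (Or.inl rfl))).2
      (hlt _ (h3 l hl))

end StutterMatching

-- Graded stutter bisimulations preserve formulas

section Invariance

universe u

variable {AP : Type u} {Q A Q' A' : Type*} {M : LTS AP Q A} {N : LTS AP Q' A'}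

/-- A family of relations graded by the number of path quantifiers that it respects. -/
structure StutterBisim (M : LTS AP Q A) (N : LTS AP Q' A') (R : ℕ → Q → Q' → Prop) : Prop where
  label_eq : ∀ {d q q'}, R d q q' → M.label q = N.label q'
  forth : ∀ {d q q'}, R (d + 1) q q' → ∀ π, M.IsInfPath π → π 0 = q →
    ∃ π', N.IsInfPath π' ∧ π' 0 = q' ∧ StutterMatch (R d) π π'
  back : ∀ {d q q'}, R (d + 1) q q' → ∀ π', N.IsInfPath π' → π' 0 = q' →
    ∃ π, M.IsInfPath π ∧ π 0 = q ∧ StutterMatch (fun a b => R d b a) π' π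

mutual
theorem StateFormula.sat_iff_of_bisim {R : ℕ → Q → Q' → Prop} (h : StutterBisim M N R) :
    ∀ (φ : StateFormula AP) {d : ℕ} {q : Q} {q' : Q'}, φ.depth ≤ d → R d q q' →
      (φ.Sat M q ↔ φ.Sat N q')
  | .tt, d, q, q', _, _ => by simp only [StateFormula.Sat]
  | .atom p, d, q, q', _, hR => by simp only [StateFormula.Sat, h.label_eq hR]
  | .not φ, d, q, q', hd, hR => by
    have := StateFormula.sat_iff_of_bisim h φ (by simpa only [StateFormula.depth] using hd) hR
    simp only [StateFormula.Sat, this]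
  | .and φ ψ, d, q, q', hd, hR => by
    simp only [StateFormula.depth, max_le_iff] at hd
    have h1 := StateFormula.sat_iff_of_bisim h φ hd.1 hR
    have h2 := StateFormula.sat_iff_of_bisim h ψ hd.2 hR
    simp only [StateFormula.Sat, h1, h2]
  | .ex φ, 0, q, q', hd, hR => by simp [StateFormula.depth] at hd
  | .ex φ, d + 1, q, q', hd, hR => by
    simp only [StateFormula.depth, Nat.add_le_add_iff_right] at hd
    simp only [StateFormula.Sat]
    constructor
    · rintro ⟨π, hπ, h0, hs⟩
      obtain ⟨π', hπ', h0', hm⟩ := h.forth hR π hπ h0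
      exact ⟨π', hπ', h0', (PathFormula.sat_iff_of_bisim h φ hd).1 hm |>.1 hs⟩
    · rintro ⟨π', hπ', h0', hs⟩
      obtain ⟨π, hπ, h0, hm⟩ := h.back hR π' hπ' h0'
      exact ⟨π, hπ, h0, (PathFormula.sat_iff_of_bisim h φ hd).2 hm |>.2 hs⟩

/-- Matching is asymmetric: one state faces a block. Paths supplied by `forth` are matched from `M`
to `N`, those supplied by `back` from `N` to `M`, so the induction carries both orientations. -/
theorem PathFormula.sat_iff_of_bisim {R : ℕ → Q → Q' → Prop} (h : StutterBisim M N R) :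
    ∀ (φ : PathFormula AP) {d : ℕ} {π : ℕ → Q} {π' : ℕ → Q'}, φ.depth ≤ d →
      (StutterMatch (R d) π π' → (φ.Sat M π ↔ φ.Sat N π')) ∧
      (StutterMatch (fun a b => R d b a) π' π → (φ.Sat M π ↔ φ.Sat N π'))
  | .state φ, d, π, π', hd => by
    simp only [PathFormula.depth] at hd
    simp only [PathFormula.Sat]
    exact ⟨fun hm => StateFormula.sat_iff_of_bisim h φ hd hm.head,
      fun hm => StateFormula.sat_iff_of_bisim h φ hd hm.head⟩
  | .not φ, d, π, π', hd => by
    simp only [PathFormula.depth] at hd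
    have := PathFormula.sat_iff_of_bisim h φ (π := π) (π' := π') hd
    simp only [PathFormula.Sat]
    exact ⟨fun hm => not_congr (this.1 hm), fun hm => not_congr (this.2 hm)⟩
  | .and φ ψ, d, π, π', hd => by
    simp only [PathFormula.depth, max_le_iff] at hd
    have h1 := PathFormula.sat_iff_of_bisim h φ (π := π) (π' := π') hd.1
    have h2 := PathFormula.sat_iff_of_bisim h ψ (π := π) (π' := π') hd.2
    simp only [PathFormula.Sat]
    exact ⟨fun hm => and_congr (h1.1 hm) (h2.1 hm), fun hm => and_congr (h1.2 hm) (h2.2 hm)⟩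
  | .until φ ψ, d, π, π', hd => by
    simp only [PathFormula.depth, max_le_iff] at hd
    simp only [PathFormula.Sat]
    constructor
    · intro hm
      exact until_iff_of_match (fun σ σ' hm => (PathFormula.sat_iff_of_bisim h φ hd.1).1 hm)
        (fun σ σ' hm => (PathFormula.sat_iff_of_bisim h ψ hd.2).1 hm) hm
    · intro hm
      exact (until_iff_of_match
        (fun σ σ' hm => ((PathFormula.sat_iff_of_bisim h φ hd.1).2 hm).symm)
        (fun σ σ' hm => ((PathFormula.sat_iff_of_bisim h ψ hd.2).2 hm).symm) hm).symm
end

end Invariance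

-- Gluing finite segments into infinite paths

section Segments

variable {α : Type*}

/-- The last clause matters when `a = b`: a closed walk must not be replaced by the empty one, as it
may be the only source of progress. -/
theorem exists_walk_of_reflTransGen {r : α → α → Prop} {a b : α} (h : ReflTransGen r a b) :
    ∃ (l : ℕ) (u : ℕ → α), u 0 = a ∧ u l = b ∧ (∀ m < l, r (u m) (u (m + 1))) ∧
      (TransGen r a b → l ≠ 0) := by
  classical
  have key : ∀ {c}, ReflTransGen r a c → ∃ (l : ℕ) (u : ℕ → α), u 0 = a ∧ u l = c ∧
      ∀ m < l, r (u m) (u (m + 1)) := by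
    intro c hc
    induction hc with
    | refl => exact ⟨0, fun _ => a, rfl, rfl, fun m hm => by omega⟩
    | @tail b c _ hbc ih =>
      obtain ⟨l, u, h0, hl, hu⟩ := ih
      refine ⟨l + 1, fun m => if m ≤ l then u m else c, by simpa using h0, by simp,
        fun m hm => ?_⟩
      rcases (Nat.lt_succ_iff.1 hm).eq_or_lt with rfl | hm
      · simpa [hl] using hbc
      · have h1 : m ≤ l := hm.le
        have h2 : m + 1 ≤ l := hm
        simpa [h1, h2] using hu m hm
  by_cases ht : TransGen r a b
  · obtain ⟨c, hac, hcb⟩ := TransGen.tail'_iff.1 ht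
    obtain ⟨l, u, h0, hl, hu⟩ := key hac
    refine ⟨l + 1, fun m => if m ≤ l then u m else b, by simpa using h0, by simp,
      fun m hm => ?_, fun _ => by omega⟩
    rcases (Nat.lt_succ_iff.1 hm).eq_or_lt with rfl | hm
    · simpa [hl] using hcb
    · have h1 : m ≤ l := hm.le
      have h2 : m + 1 ≤ l := hm
      simpa [h1, h2] using hu m hm
  · obtain ⟨l, u, h0, hl, hu⟩ := key h
    exact ⟨l, u, h0, hl, hu, fun h => absurd h ht⟩

/-- Infinitely many finite segments, infinitely many of them nonempty, form an infinite path. -/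
theorem exists_path_of_segments {T : α → α → Prop} {S : ℕ → α → Prop} {y : ℕ → α}
    (hseg : ∀ i, ReflTransGen (fun a b => S i a ∧ T a b) (y i) (y (i + 1)))
    (hprog : ∀ n, ∃ i, n ≤ i ∧ TransGen (fun a b => S i a ∧ T a b) (y i) (y (i + 1))) :
    ∃ (π : ℕ → α) (j : ℕ → ℕ), (∀ m, T (π m) (π (m + 1))) ∧ j 0 = 0 ∧ Monotone j ∧
      (∀ n, ∃ i, n ≤ j i) ∧ (∀ i, π (j i) = y i) ∧ ∀ i m, j i ≤ m → m < j (i + 1) → S i (π m) := by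
  classical
  choose l u hu0 hul hu hpos using fun i => exists_walk_of_reflTransGen (hseg i)
  let J : ℕ → ℕ := fun i => ∑ r ∈ Finset.range i, l r
  have hJs : ∀ i, J (i + 1) = J i + l i := fun i => Finset.sum_range_succ _ _
  have hJ : Monotone J := monotone_nat_of_le_succ fun i => by rw [hJs]; omega
  have hunb : ∀ n, ∃ i, n ≤ J i := by
    intro n
    induction n with
    | zero => exact ⟨0, by omega⟩
    | succ n ih =>
      obtain ⟨i, hi⟩ := ih
      obtain ⟨i', hi', ht⟩ := hprog i
      refine ⟨i' + 1, ?_⟩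
      have := hJ hi'
      have := hpos i' ht
      rw [hJs]; omega
  have hex : ∀ m, ∃ i, m < J (i + 1) := fun m => by
    obtain ⟨i, hi⟩ := hunb (m + 1)
    have := hJ (show i ≤ i + 1 by omega)
    exact ⟨i, by omega⟩
  -- The least `i` with `m < J (i + 1)` is the unique nonempty block containing `m`.
  let π : ℕ → α := fun m => u (Nat.find (hex m)) (m - J (Nat.find (hex m)))
  have hπ : ∀ i m, J i ≤ m → m < J (i + 1) → π m = u i (m - J i) := by
    intro i m h1 h2
    have : Nat.find (hex m) = i := by
      refine le_antisymm (Nat.find_min' _ h2) (not_lt.1 fun h => ?_)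
      have h3 := Nat.find_spec (hex m)
      have := hJ (show Nat.find (hex m) + 1 ≤ i from h)
      omega
    simp only [π, this]
  -- Empty segments do not change the endpoint. Hence the start of an empty block, which is read off
  -- from the next nonempty block, still carries the right state.
  have hconst : ∀ i r, J (i + r) = J i → y (i + r) = y i := by
    intro i r
    induction r with
    | zero => intro _; rfl
    | succ r ih =>
      intro h
      rw [← add_assoc, hJs] at h
      have := hJ (show i ≤ i + r by omega)
      have hl0 : l (i + r) = 0 := by omega
      rw [← ih (by omega), ← add_assoc, ← hul (i + r), hl0, hu0]
  have hstart : ∀ i, π (J i) = y i := by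
    intro i
    have h1 := Nat.find_spec (hex (J i))
    set I := Nat.find (hex (J i)) with hI
    have hle : i ≤ I := by
      by_contra h
      have := hJ (show I + 1 ≤ i by omega)
      omega
    have h2 : J I ≤ J i := by
      rcases hle.eq_or_lt with h | h
      · rw [h]
      · have h3 := Nat.find_min (hex (J i)) (show I - 1 < Nat.find (hex (J i)) by omega)
        rw [Nat.sub_add_cancel (by omega)] at h3
        omega
    have h3 : J I = J i := le_antisymm h2 (hJ hle)
    rw [hπ I (J i) h2 h1, h3, Nat.sub_self, hu0]
    obtain ⟨r, hr⟩ := Nat.exists_eq_add_of_le hle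
    rw [hr] at h3 ⊢
    exact hconst i r h3
  have hnext : ∀ i m, J i ≤ m → m < J (i + 1) → π (m + 1) = u i (m + 1 - J i) := by
    intro i m h1 h2
    rcases (Nat.succ_le_of_lt h2).eq_or_lt with h | h
    · have h' : m + 1 - J i = l i := by have := hJs i; omega
      rw [show m + 1 = J (i + 1) from h, hstart, ← h, h', hul]
    · exact hπ i (m + 1) (by omega) h
  have hstep : ∀ i m, J i ≤ m → m < J (i + 1) → S i (π m) ∧ T (π m) (π (m + 1)) := by
    intro i m h1 h2
    rw [hnext i m h1 h2, hπ i m h1 h2, Nat.sub_add_comm h1]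
    exact hu i _ (by have := hJs i; omega)
  refine ⟨π, J, fun m => ?_, by simp [J], hJ, hunb, hstart, fun i m h1 h2 => (hstep i m h1 h2).1⟩
  obtain ⟨i, hi, hlt⟩ := exists_block_of_lt (j := J) (by simp [J]) (hex m).choose_spec
  exact (hstep i m hlt.1 hlt.2).2

/-- A path may be built segment by segment, as long as an invariant can be maintained. -/
theorem exists_stutterMatch_of_invariant {β : Type*} {T : α → α → Prop} {R : β → α → Prop}
    {Inv : ℕ → α → Prop} {π : ℕ → β} {q : α} (h0 : Inv 0 q) (hR : ∀ i a, Inv i a → R (π i) a)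
    {prog : ℕ → Prop} (hprog : ∀ n, ∃ i, n ≤ i ∧ prog i)
    (hstep : ∀ i a, Inv i a → ∃ b, Inv (i + 1) b ∧
      ReflTransGen (fun x y => R (π i) x ∧ T x y) a b ∧
      (prog i → TransGen (fun x y => R (π i) x ∧ T x y) a b)) :
    ∃ π' : ℕ → α, (∀ m, T (π' m) (π' (m + 1))) ∧ π' 0 = q ∧ StutterMatch R π π' := by
  choose! f hf1 hf2 hf3 using hstep
  let y : ℕ → α := fun i => Nat.rec q (fun i a => f i a) i
  have hy : ∀ i, Inv i (y i) := fun i => by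
    induction i with
    | zero => exact h0
    | succ i ih => exact hf1 i _ ih
  obtain ⟨π', j, h1, h2, h3, h4, h5, h6⟩ := exists_path_of_segments
    (fun i => hf2 i (y i) (hy i)) (fun n => by
      obtain ⟨i, hi, hp⟩ := hprog n
      exact ⟨i, hi, hf3 i (y i) (hy i) hp⟩)
  refine ⟨π', h1, ?_, j, h2, h3, h4, fun i => ?_, h6⟩
  · rw [← h2, h5 0]; rfl
  · rw [h5]; exact hR i _ (hy i)

end Segments

-- Depth types and path matching between finite systems

section StateTypes

universe u

variable {AP : Type u} {Q A Q' A' : Type*}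

/-- One step of a transition system, with any action. -/
def LTS.Step (M : LTS AP Q A) (q q' : Q) : Prop := ∃ a, M.trans q a q'

theorem LTS.isInfPath_iff {M : LTS AP Q A} {π : ℕ → Q} :
    M.IsInfPath π ↔ ∀ i, M.Step (π i) (π (i + 1)) :=
  ⟨fun ⟨a, ha⟩ i => ⟨a i, ha i⟩, fun h => by choose a ha using h; exact ⟨a, ha⟩⟩

theorem LTS.IsInfPath.suffix {M : LTS AP Q A} {π : ℕ → Q} (h : M.IsInfPath π) (n : ℕ) :
    M.IsInfPath (fun m => π (n + m)) := by
  rw [LTS.isInfPath_iff] at h ⊢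
  exact fun i => h (n + i)

/-- The formulas of quantifier depth at most `d` that hold in a state. -/
def LTS.stateType (M : LTS AP Q A) (d : ℕ) (q : Q) : Set (StateFormula AP) :=
  {φ | φ.depth ≤ d ∧ φ.Sat M q}

theorem stateType_eq_iff {M : LTS AP Q A} {N : LTS AP Q' A'} {d : ℕ} {q : Q} {q' : Q'} :
    M.stateType d q = N.stateType d q' ↔
      ∀ φ : StateFormula AP, φ.depth ≤ d → (φ.Sat M q ↔ φ.Sat N q') := by
  simp only [LTS.stateType, Set.ext_iff, Set.mem_ofPred_eq]
  exact forall_congr' fun φ => by tauto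

theorem label_eq_of_stateType_eq {M : LTS AP Q A} {N : LTS AP Q' A'} {d : ℕ} {q : Q} {q' : Q'}
    (h : M.stateType d q = N.stateType d q') : M.label q = N.label q' := by
  ext p
  have := stateType_eq_iff.1 h (.atom p) (by simp [StateFormula.depth])
  simpa only [StateFormula.Sat] using this

/-- If two states have different types, a formula holds in the first and fails in the second. -/
theorem exists_separating_formula {M : LTS AP Q A} {N : LTS AP Q' A'} {d : ℕ} {q : Q} {q' : Q'}
    (h : M.stateType d q ≠ N.stateType d q') :
    ∃ φ : StateFormula AP, φ.depth ≤ d ∧ φ.Sat M q ∧ ¬ φ.Sat N q' := by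
  rw [Ne, stateType_eq_iff] at h
  push Not at h
  obtain ⟨φ, hd, ⟨h1, h2⟩ | ⟨h1, h2⟩⟩ := h
  · exact ⟨φ, hd, h1, h2⟩
  · exact ⟨.not φ, by simpa only [StateFormula.depth] using hd,
      by simpa only [StateFormula.Sat] using h1, by simpa only [StateFormula.Sat, not_not] using h2⟩

/-- A state is characterized among the states of a finite system by a single formula. -/
theorem exists_characteristic_formula [Finite Q'] (M : LTS AP Q A) (N : LTS AP Q' A') (d : ℕ)
    (q : Q) : ∃ φ : StateFormula AP, φ.depth ≤ d ∧ φ.Sat M q ∧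
      ∀ q', φ.Sat N q' → M.stateType d q = N.stateType d q' := by
  classical
  have := Fintype.ofFinite Q'
  have key : ∀ s : Finset Q', ∃ φ : StateFormula AP, φ.depth ≤ d ∧ φ.Sat M q ∧
      ∀ q' ∈ s, φ.Sat N q' → M.stateType d q = N.stateType d q' := by
    intro s
    induction s using Finset.induction_on with
    | empty => exact ⟨.tt, by simp [StateFormula.depth], by simp [StateFormula.Sat], by simp⟩
    | insert a s _ ih =>
      obtain ⟨φ, h1, h2, h3⟩ := ih
      by_cases ha : M.stateType d q = N.stateType d a
      · refine ⟨φ, h1, h2, fun q' hq' hs => ?_⟩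
        rcases Finset.mem_insert.1 hq' with rfl | hq'
        · exact ha
        · exact h3 q' hq' hs
      · obtain ⟨ψ, g1, g2, g3⟩ := exists_separating_formula ha
        refine ⟨.and φ ψ, by simp [StateFormula.depth, h1, g1],
          by simp only [StateFormula.Sat]; exact ⟨h2, g2⟩, fun q' hq' hs => ?_⟩
        simp only [StateFormula.Sat] at hs
        rcases Finset.mem_insert.1 hq' with rfl | hq'
        · exact absurd hs.2 g3
        · exact h3 q' hq' hs.1
  obtain ⟨φ, h1, h2, h3⟩ := key Finset.univ
  exact ⟨φ, h1, h2, fun q' => h3 q' (Finset.mem_univ _)⟩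

open Classical in
/-- The path formula saying that a path runs through the state formulas `C i, …, C (i + m)` in this
order and, if `K` holds at the last index, satisfies the last one forever. -/
noncomputable def chainFormula (C : ℕ → StateFormula AP) (K : ℕ → Prop) : ℕ → ℕ → PathFormula AP
  | 0, i => if K i then .not (.until (.state .tt) (.not (.state (C i)))) else .state (C i)
  | m + 1, i => .and (.state (C i)) (.until (.state (C i)) (chainFormula C K m (i + 1)))

variable {C : ℕ → StateFormula AP} {K : ℕ → Prop}

theorem chainFormula_depth_le {d : ℕ} (hC : ∀ i, (C i).depth ≤ d) (m i : ℕ) :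
    (chainFormula C K m i).depth ≤ d := by
  induction m generalizing i with
  | zero =>
    rw [chainFormula]
    split_ifs <;> simp [PathFormula.depth, StateFormula.depth, hC]
  | succ m ih => simp [chainFormula, PathFormula.depth, hC, ih]

theorem sat_chainFormula_zero {N : LTS AP Q' A'} {i : ℕ} {σ : ℕ → Q'} :
    (chainFormula C K 0 i).Sat N σ ↔ (C i).Sat N (σ 0) ∧ (K i → ∀ m, (C i).Sat N (σ m)) := by
  rw [chainFormula]
  split_ifs with h
  · simp only [PathFormula.Sat, StateFormula.Sat, implies_true, and_true, not_exists, not_not,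
      add_zero, h, true_implies]
    exact ⟨fun h => ⟨h 0, h⟩, fun h => h.2⟩
  · simp [PathFormula.Sat, h]

theorem sat_chainFormula_succ {N : LTS AP Q' A'} {m i : ℕ} {σ : ℕ → Q'} :
    (chainFormula C K (m + 1) i).Sat N σ ↔ (C i).Sat N (σ 0) ∧
      ∃ j, (chainFormula C K m (i + 1)).Sat N (fun t => σ (j + t)) ∧
        ∀ l < j, (C i).Sat N (σ l) := by
  simp only [chainFormula, PathFormula.Sat, add_zero]

theorem sat_head_of_sat_chainFormula {N : LTS AP Q' A'} {m i : ℕ} {σ : ℕ → Q'}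
    (h : (chainFormula C K m i).Sat N σ) : (C i).Sat N (σ 0) := by
  cases m with
  | zero => exact (sat_chainFormula_zero.1 h).1
  | succ m => exact (sat_chainFormula_succ.1 h).1

/-- Longer chains imply shorter ones, so a chain property that holds for infinitely many lengths
holds for all. The delicate case is the last index: the "forever" clause at `i` must be recovered
from the one at `i + 1`, which is what `hK` provides. -/
theorem sat_chainFormula_of_sat_succ {N : LTS AP Q' A'}
    (hK : ∀ i, K i → K (i + 1) ∧ ∀ q, (C (i + 1)).Sat N q → (C i).Sat N q) {m i : ℕ} {σ : ℕ → Q'}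
    (h : (chainFormula C K (m + 1) i).Sat N σ) : (chainFormula C K m i).Sat N σ := by
  induction m generalizing i σ with
  | zero =>
    obtain ⟨h1, j, h2, h3⟩ := sat_chainFormula_succ.1 h
    refine sat_chainFormula_zero.2 ⟨h1, fun hi m => ?_⟩
    by_cases hm : m < j
    · exact h3 m hm
    · have := (sat_chainFormula_zero.1 h2).2 (hK i hi).1 (m - j)
      rw [Nat.add_sub_cancel' (by omega)] at this
      exact (hK i hi).2 _ this
  | succ m ih =>
    obtain ⟨h1, j, h2, h3⟩ := sat_chainFormula_succ.1 h
    exact sat_chainFormula_succ.2 ⟨h1, j, ih h2, h3⟩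

/-- Between finite systems, paths can be matched if one more path quantifier is preserved. -/
theorem exists_stutterMatch_of_stateType_eq [Finite Q'] {M : LTS AP Q A} {N : LTS AP Q' A'}
    {d : ℕ} {q : Q} {q' : Q'} (h : M.stateType (d + 1) q = N.stateType (d + 1) q') {π : ℕ → Q}
    (hπ : M.IsInfPath π) (h0 : π 0 = q) :
    ∃ π', N.IsInfPath π' ∧ π' 0 = q' ∧
      StutterMatch (fun a b => M.stateType d a = N.stateType d b) π π' := by
  choose c hc1 hc2 hc3 using exists_characteristic_formula M N d
  let C : ℕ → StateFormula AP := fun i => c (π i)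
  -- From time `i` on, the type along `π` no longer changes.
  let K : ℕ → Prop := fun i => ∀ r, i ≤ r → M.stateType d (π r) = M.stateType d (π i)
  -- characteristic formulas characterize exactly
  have hCM : ∀ i a, M.stateType d (π i) = M.stateType d a → (C i).Sat M a := fun i a ha =>
    (stateType_eq_iff.1 ha _ (hc1 _)).1 (hc2 _)
  have hCN : ∀ i b, (C i).Sat N b ↔ M.stateType d (π i) = N.stateType d b := fun i b =>
    ⟨hc3 _ _, fun hb => (stateType_eq_iff.1 hb _ (hc1 _)).1 (hc2 _)⟩
  have hK : ∀ i, K i → K (i + 1) ∧ ∀ q, (C (i + 1)).Sat N q → (C i).Sat N q := by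
    intro i hi
    refine ⟨fun r hr => ?_, fun b hb => ?_⟩
    · rw [hi r (by omega), hi (i + 1) (by omega)]
    · rw [hCN] at hb ⊢
      rw [← hb, hi (i + 1) (by omega)]
  have hsat : ∀ m i, (chainFormula C K m i).Sat M (fun t => π (i + t)) := by
    intro m
    induction m with
    | zero =>
      exact fun i => sat_chainFormula_zero.2 ⟨hCM i _ rfl, fun hi r =>
        hCM i _ (hi (i + r) (by omega)).symm⟩
    | succ m ih =>
      refine fun i => sat_chainFormula_succ.2 ⟨hCM i _ rfl, 1, ?_, fun l hl => ?_⟩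
      · simpa only [add_assoc] using ih (i + 1)
      · obtain rfl : l = 0 := by omega
        exact hCM i _ rfl
  -- A König argument: `b` can follow every finite piece of the type sequence of `π` from time `i`
  -- on. Each piece is one formula of depth `d + 1`, so the hypothesis gives the invariant at the
  -- start.
  let Inv : ℕ → Q' → Prop := fun i b => ∀ m, (StateFormula.ex (chainFormula C K m i)).Sat N b
  have hInv0 : Inv 0 q' := by
    intro m
    refine (stateType_eq_iff.1 h _ ?_).1 ?_
    · simpa [StateFormula.depth] using chainFormula_depth_le (fun i => hc1 (π i)) m 0
    · simp only [StateFormula.Sat]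
      exact ⟨π, hπ, h0, by simpa using hsat m 0⟩
  have hInvR : ∀ i b, Inv i b → M.stateType d (π i) = N.stateType d b := by
    intro i b hb
    have := hb 0
    simp only [StateFormula.Sat] at this
    obtain ⟨σ, -, rfl, hσ⟩ := this
    exact (hCN i _).1 (sat_head_of_sat_chainFormula hσ)
  have hwalk : ∀ i (σ : ℕ → Q'), N.IsInfPath σ → ∀ j, (∀ l < j, (C i).Sat N (σ l)) →
      ReflTransGen (fun x y => M.stateType d (π i) = N.stateType d x ∧ N.Step x y)
        (σ 0) (σ j) := by
    intro i σ hσ j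
    induction j with
    | zero => exact fun _ => .refl
    | succ j ih =>
      exact fun hl => (ih fun l h => hl l (by omega)).tail
        ⟨(hCN i _).1 (hl j (by omega)), LTS.isInfPath_iff.1 hσ j⟩
  suffices hex : ∃ π' : ℕ → Q', (∀ m, N.Step (π' m) (π' (m + 1))) ∧ π' 0 = q' ∧
      StutterMatch (fun a b => M.stateType d a = N.stateType d b) π π' by
    obtain ⟨π', h1, h2, h3⟩ := hex
    exact ⟨π', LTS.isInfPath_iff.2 h1, h2, h3⟩
  refine exists_stutterMatch_of_invariant (T := N.Step) (Inv := Inv)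
    -- Either the type changes infinitely often, and each change forces a step, or it stabilizes,
    -- and then every index must contribute a step.
    (prog := fun i => K i ∨ M.stateType d (π i) ≠ M.stateType d (π (i + 1))) hInv0 hInvR ?_ ?_
  · intro n
    by_contra hcon
    push Not at hcon
    refine (hcon n le_rfl).1 fun r hr => ?_
    induction r, hr using Nat.le_induction with
    | base => rfl
    | succ r hr ih => rw [← (hcon r hr).2, ih]
  · intro i b hb
    by_cases hi : K i
    -- In the stable case the chain of length zero already gives an infinite path within the type.
    -- One step along it is taken, and its tail witnesses all further chains.
    · have := hb 0
      simp only [StateFormula.Sat] at this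
      obtain ⟨σ, hσ, rfl, hs⟩ := this
      have hall := (sat_chainFormula_zero.1 hs).2 hi
      have hstep : TransGen (fun x y => M.stateType d (π i) = N.stateType d x ∧ N.Step x y)
          (σ 0) (σ 1) := .single ⟨(hCN i _).1 (hall 0), LTS.isInfPath_iff.1 hσ 0⟩
      refine ⟨σ 1, fun m => ?_, hstep.to_reflTransGen, fun _ => hstep⟩
      simp only [StateFormula.Sat]
      refine ⟨fun t => σ (1 + t), hσ.suffix 1, rfl, ?_⟩
      have hall' : ∀ r t, i ≤ r → (C r).Sat N (σ t) := fun r t hr =>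
        (hCN r _).2 (by rw [hi r hr]; exact (hCN i _).1 (hall t))
      have : ∀ m r n, i ≤ r → (chainFormula C K m r).Sat N (fun t => σ (n + t)) := by
        intro m
        induction m with
        | zero => exact fun r n hr => sat_chainFormula_zero.2 ⟨hall' _ _ hr, fun _ _ => hall' _ _ hr⟩
        | succ m ih =>
          exact fun r n hr => sat_chainFormula_succ.2 ⟨hall' _ _ hr, 0,
            by simpa using ih (r + 1) n (by omega), by simp⟩
      exact this m (i + 1) 1 (by omega)
    · have hex : ∃ b', Inv (i + 1) b' ∧
          ReflTransGen (fun x y => M.stateType d (π i) = N.stateType d x ∧ N.Step x y) b b' := by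
        have hm : ∀ m, ∃ b', ReflTransGen
            (fun x y => M.stateType d (π i) = N.stateType d x ∧ N.Step x y) b b' ∧
            (StateFormula.ex (chainFormula C K m (i + 1))).Sat N b' := by
          intro m
          have := hb (m + 1)
          simp only [StateFormula.Sat] at this
          obtain ⟨σ, hσ, rfl, hs⟩ := this
          obtain ⟨-, j, hj, hl⟩ := sat_chainFormula_succ.1 hs
          refine ⟨σ j, hwalk i σ hσ j hl, ?_⟩
          simp only [StateFormula.Sat]
          exact ⟨fun t => σ (j + t), hσ.suffix j, rfl, hj⟩
        -- The successor state depends on the length `m`; by finiteness one state serves infinitely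
        -- many lengths, hence all of them.
        choose f hf1 hf2 using hm
        obtain ⟨b', hb'⟩ := Finite.exists_infinite_fiber f
        rw [Set.infinite_coe_iff] at hb'
        have hanti : ∀ m n, m ≤ n → (StateFormula.ex (chainFormula C K n (i + 1))).Sat N b' →
            (StateFormula.ex (chainFormula C K m (i + 1))).Sat N b' := by
          intro m n hmn
          induction n, hmn using Nat.le_induction with
          | base => exact id
          | succ n _ ih =>
            intro hs
            apply ih
            simp only [StateFormula.Sat] at hs ⊢
            obtain ⟨σ, hσ, h0, hs⟩ := hs
            exact ⟨σ, hσ, h0, sat_chainFormula_of_sat_succ hK hs⟩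
        refine ⟨b', fun m => ?_, ?_⟩
        · obtain ⟨n, hn, hmn⟩ := hb'.exists_gt m
          have hn : f n = b' := hn
          exact hanti m n hmn.le (hn ▸ hf2 n)
        · obtain ⟨n, hn⟩ := hb'.nonempty
          have hn : f n = b' := hn
          exact hn ▸ hf1 n
      obtain ⟨b', hb1, hb2⟩ := hex
      refine ⟨b', hb1, hb2, fun hp => ?_⟩
      rcases reflTransGen_iff_eq_or_transGen.1 hb2 with heq | ht
      · refine absurd ?_ (hp.resolve_left hi)
        rw [hInvR i b hb, hInvR (i + 1) b' hb1, heq]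
      · exact ht

end StateTypes

open Function

-- Internal runs of templates terminate

section Templates

variable {AP Q I : Type*} (P : Template AP Q I)

theorem exists_apply_eq_of_mem_omegaPower {α : Type*} {L : Language α} {x : α} {w : ℕ → α}
    (h : w ∈ omegaPower (L * {[x]})) : ∃ m, w m = x := by
  obtain ⟨n, -, -, hn⟩ := h
  obtain ⟨u, -, v, rfl, huv⟩ := Language.mem_mul.1 (hn 0)
  have : x ∈ (List.range' (n 0) (n (0 + 1) - n 0)).map w := by
    rw [← huv]; exact List.mem_append_right _ (List.mem_singleton.2 rfl)
  obtain ⟨m, -, hm⟩ := List.mem_map.1 this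
  exact ⟨m, hm⟩

/-- An internal transition of a template. -/
def Template.IntStep (q q' : Q) : Prop := ∃ a, P.trans q (.int a) q'

/-- An infinite internal run would have a label word without `snd` and `rcv`, whereas every block of
an admissible word ends in one of them. -/
theorem Template.wellFounded_intStep : WellFounded (fun q' q => P.IntStep q q') := by
  refine wellFounded_iff_isEmpty_descending_chain.2 ⟨fun ⟨q, hq⟩ => ?_⟩
  choose a ha using hq
  rcases P.alternate (fun i => .int (a i)) ⟨q, ha⟩ with h | h
  · obtain ⟨m, hm⟩ := exists_apply_eq_of_mem_omegaPower h
    cases hm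
  · obtain ⟨m, hm⟩ := exists_apply_eq_of_mem_omegaPower h
    cases hm

variable {P}

theorem Template.exists_snd {q : Q} (hq : q ∈ P.hasTok) :
    ∃ q₁ q₂, ReflTransGen P.IntStep q q₁ ∧ P.trans q₁ .snd q₂ := by
  induction q using P.wellFounded_intStep.induction with
  | _ q ih =>
    obtain ⟨a, q', h⟩ := P.total q
    cases a with
    | int a =>
      obtain ⟨q₁, q₂, h₁, h₂⟩ := ih q' ⟨a, h⟩ ((P.int_tok _ _ _ h).1 hq)
      exact ⟨q₁, q₂, .head ⟨a, h⟩ h₁, h₂⟩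
    | snd => exact ⟨q, q', .refl, h⟩
    | rcv => exact absurd hq (P.rcv_tok _ _ h).1

theorem Template.exists_rcv {q : Q} (hq : q ∉ P.hasTok) :
    ∃ q₁ q₂, ReflTransGen P.IntStep q q₁ ∧ P.trans q₁ .rcv q₂ := by
  induction q using P.wellFounded_intStep.induction with
  | _ q ih =>
    obtain ⟨a, q', h⟩ := P.total q
    cases a with
    | int a =>
      obtain ⟨q₁, q₂, h₁, h₂⟩ := ih q' ⟨a, h⟩ fun h' => hq ((P.int_tok _ _ _ h).2 h')
      exact ⟨q₁, q₂, .head ⟨a, h⟩ h₁, h₂⟩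
    | snd => exact absurd (P.snd_tok _ _ h).1 hq
    | rcv => exact ⟨q, q', .refl, h⟩

end Templates

-- Token movement in token-passing systems

section Systems

variable {AP Q I : Type*} (P : Template AP Q I) {G : Topology} {k : ℕ}

/-- Exactly the process at `v` has the token. -/
def HasTokenAt (s : G.Vertex → Q) (v : G.Vertex) : Prop := ∀ u, s u ∈ P.hasTok ↔ u = v

/-- One process makes an internal transition. -/
def IntMove (s s' : G.Vertex → Q) : Prop :=
  ∃ v, P.IntStep (s v) (s' v) ∧ ∀ w, w ≠ v → s w = s' w

/-- The process at `v` passes the token to the process at `w`. -/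
def TokMove (v w : G.Vertex) (s s' : G.Vertex → Q) : Prop :=
  G.edge v w ∧ P.trans (s v) .snd (s' v) ∧ P.trans (s w) .rcv (s' w) ∧
    ∀ u, u ≠ v → u ≠ w → s' u = s u

variable {P} {g : Fin k → G.Vertex} {s s' : G.Vertex → Q} {v w : G.Vertex}

theorem step_projection_iff :
    (projection P G g).Step s s' ↔ IntMove P s s' ∨ ∃ v w, TokMove P v w s s' := by
  constructor
  · rintro ⟨a | _, h⟩
    · obtain ⟨v, h1, h2⟩ := h
      exact Or.inl ⟨v, ⟨a, h1⟩, h2⟩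
    · exact Or.inr h
  · rintro (⟨v, ⟨a, h1⟩, h2⟩ | h)
    · exact ⟨.int a, v, h1, h2⟩
    · exact ⟨.tok, h⟩

theorem HasTokenAt.unique (h : HasTokenAt P s v) (h' : HasTokenAt P s w) : v = w :=
  (h' v).1 ((h v).2 rfl)

theorem HasTokenAt.intMove (h : HasTokenAt P s v) (hm : IntMove P s s') : HasTokenAt P s' v := by
  obtain ⟨w, ⟨a, ha⟩, hne⟩ := hm
  intro u
  rw [← h u]
  by_cases hu : u = w
  · subst hu; exact (P.int_tok _ _ _ ha).symm
  · rw [hne u hu]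

theorem TokMove.eq_of_hasTokenAt {u : G.Vertex} (hm : TokMove P v w s s')
    (h : HasTokenAt P s u) : v = u :=
  (h v).1 (P.snd_tok _ _ hm.2.1).1

theorem TokMove.hasTokenAt {u : G.Vertex} (hm : TokMove P v w s s') (h : HasTokenAt P s u) :
    HasTokenAt P s' w := by
  obtain rfl := hm.eq_of_hasTokenAt h
  obtain ⟨he, h1, h2, h3⟩ := hm
  intro u
  by_cases huw : u = w
  · subst huw; exact iff_of_true (P.rcv_tok _ _ h2).2 rfl
  · by_cases huv : u = v
    · subst huv; exact iff_of_false (P.snd_tok _ _ h1).2 huw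
    · rw [h3 u huv huw, h u]; exact iff_of_false huv huw

/-- An internal move decreases a single coordinate, hence descends lexicographically in a finite
product of well-founded relations. -/
theorem wellFounded_intMove : WellFounded (fun s' s : G.Vertex → Q => IntMove P s s') := by
  refine Subrelation.wf (r := Pi.Lex (· < ·) fun q' q => P.IntStep q q') ?_
    (Pi.Lex.wellFounded _ fun _ => P.wellFounded_intStep)
  rintro s' s ⟨v, h1, h2⟩
  exact ⟨v, fun w hw => (h2 w hw.ne).symm, h1⟩

/-- The token travels along an infinite path of the topology. The number of moves that it made
before time `t` is `h t`. -/
theorem exists_token_path {x : ℕ → G.Vertex → Q} (hx : (projection P G g).IsInfPath x)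
    (hv : HasTokenAt P (x 0) v) :
    ∃ (p : ℕ → G.Vertex) (h : ℕ → ℕ), p 0 = v ∧ h 0 = 0 ∧ (graphLTS G g).IsInfPath p ∧
      (∀ n, ∃ t, n ≤ h t) ∧ (∀ t, HasTokenAt P (x t) (p (h t))) ∧
      ∀ t, (h (t + 1) = h t ∧ IntMove P (x t) (x (t + 1))) ∨
        (h (t + 1) = h t + 1 ∧ TokMove P (p (h t)) (p (h t + 1)) (x t) (x (t + 1))) := by
  classical
  have hstep : ∀ t, IntMove P (x t) (x (t + 1)) ∨ ∃ v w, TokMove P v w (x t) (x (t + 1)) :=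
    fun t => step_projection_iff.1 (LTS.isInfPath_iff.1 hx t)
  let B : ℕ → Prop := fun t => ∃ v w, TokMove P v w (x t) (x (t + 1))
  have hint : ∀ t, ¬ B t → IntMove P (x t) (x (t + 1)) := fun t h => (hstep t).resolve_right h
  have hex : ∀ t, ∃ u, HasTokenAt P (x t) u := by
    intro t
    induction t with
    | zero => exact ⟨v, hv⟩
    | succ t ih =>
      obtain ⟨u, hu⟩ := ih
      rcases hstep t with h | ⟨_, w, h⟩
      · exact ⟨u, hu.intMove h⟩
      · exact ⟨w, h.hasTokenAt hu⟩
  choose tk htk using hex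
  have hinf : {t | B t}.Infinite := by
    refine Set.infinite_of_not_bddAbove fun ⟨n, hn⟩ => ?_
    have := wellFounded_iff_isEmpty_descending_chain.1 (wellFounded_intMove (P := P) (G := G))
    refine this.false ⟨fun t => x (n + 1 + t), fun t => hint (n + 1 + t) fun h => ?_⟩
    have : n + 1 + t ≤ n := hn h
    omega
  have hcount : ∀ t r, Nat.count B (t + r) = Nat.count B t → tk (t + r) = tk t := by
    intro t r
    induction r with
    | zero => intro _; rfl
    | succ r ih =>
      intro h
      rw [← add_assoc, Nat.count_succ] at h
      have hle := Nat.count_monotone B (show t ≤ t + r by omega)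
      have hB : ¬ B (t + r) := fun hB => by rw [if_pos hB] at h; omega
      rw [if_neg hB] at h
      rw [← ih (by omega)]
      exact (htk (t + (r + 1))).unique ((htk (t + r)).intMove (hint _ hB))
  -- The holder at time `t` depends only on the number of earlier token moves. So the `i`-th vertex
  -- of the path may be read off at the time when move number `i` (counted from `0`) happens.
  have hcount' : ∀ t t', Nat.count B t = Nat.count B t' → tk t = tk t' := by
    intro t t' h
    rcases le_total t t' with hle | hle
    · obtain ⟨r, rfl⟩ := Nat.exists_eq_add_of_le hle
      exact (hcount t r h.symm).symm
    · obtain ⟨r, rfl⟩ := Nat.exists_eq_add_of_le hle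
      exact hcount t' r h
  have hnth : ∀ i, Nat.count B (Nat.nth B i) = i := fun i => Nat.count_nth_of_infinite hinf i
  have hp : ∀ t, tk t = tk (Nat.nth B (Nat.count B t)) := fun t => hcount' _ _ (hnth _).symm
  have hmove : ∀ t, B t → TokMove P (tk (Nat.nth B (Nat.count B t)))
      (tk (Nat.nth B (Nat.count B t + 1))) (x t) (x (t + 1)) := by
    intro t ht
    have hsucc : Nat.count B t + 1 = Nat.count B (t + 1) := by rw [Nat.count_succ, if_pos ht]
    rw [hsucc, ← hp, ← hp]
    obtain ⟨v, w, h⟩ := ht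
    rwa [← h.eq_of_hasTokenAt (htk t), ← (h.hasTokenAt (htk t)).unique (htk (t + 1))]
  refine ⟨fun i => tk (Nat.nth B i), Nat.count B, ?_, Nat.count_zero B, ⟨fun _ => (), fun i => ?_⟩,
    fun n => ⟨Nat.nth B n, (hnth n).ge⟩, fun t => ?_, fun t => ?_⟩
  · have := hp 0
    rw [Nat.count_zero] at this
    exact this.symm.trans ((htk 0).unique hv)
  · have := (hmove _ (Nat.nth_mem_of_infinite hinf i)).1
    rwa [hnth] at this
  · have := htk t
    rwa [hp] at this
  · by_cases ht : B t
    · exact Or.inr ⟨by rw [Nat.count_succ, if_pos ht], hmove t ht⟩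
    · exact Or.inl ⟨by rw [Nat.count_succ, if_neg ht, add_zero], hint t ht⟩

/-- The token is at `v`, and the observed processes are in the local states `c`. -/
def Observes (P : Template AP Q I) (g : Fin k → G.Vertex) (v : G.Vertex) (c : Fin k → Q)
    (s : G.Vertex → Q) : Prop :=
  HasTokenAt P s v ∧ ∀ i, s (g i) = c i

variable {c c' : Fin k → Q}

theorem Observes.intStep {u : G.Vertex} {q : Q} (hs : Observes P g v c s)
    (hq : P.IntStep (s u) q) :
    (projection P G g).Step s (update s u q) ∧ HasTokenAt P (update s u q) v := by
  have hm : IntMove P s (update s u q) :=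
    ⟨u, by rwa [update_self], fun w hw => by rw [update_of_ne hw]⟩
  exact ⟨step_projection_iff.2 (Or.inl hm), hs.1.intMove hm⟩

/-- An unobserved process may make internal transitions at will. -/
theorem Observes.intSteps {u : G.Vertex} {q : Q} (hs : Observes P g v c s)
    (hq : ReflTransGen P.IntStep (s u) q) (hu : u ∈ Set.range g → q = s u) :
    ReflTransGen (fun a b => Observes P g v c a ∧ (projection P G g).Step a b) s (update s u q) ∧
      Observes P g v c (update s u q) := by
  by_cases hr : u ∈ Set.range g
  · rw [hu hr, update_eq_self]
    exact ⟨.refl, hs⟩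
  · clear hu
    induction hq with
    | refl => rw [update_eq_self]; exact ⟨.refl, hs⟩
    | @tail q q' _ hq ih =>
      obtain ⟨h1, h2⟩ := ih
      have := h2.intStep (u := u) (q := q') (by rwa [update_self])
      rw [update_idem] at this
      refine ⟨h1.tail ⟨h2, this.1⟩, this.2, fun i => ?_⟩
      rw [update_of_ne fun h => hr ⟨i, h⟩]
      exact hs.2 i

/-- The token can be passed along an edge, with prescribed transitions of observed processes. -/
theorem Observes.exists_tokMove (hg : Injective g) (hs : Observes P g v c s) (he : G.edge v w)
    (hv : ∀ i, v = g i → P.trans (c i) .snd (c' i))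
    (hw : ∀ i, w = g i → P.trans (c i) .rcv (c' i))
    (hne : ∀ i, v ≠ g i → w ≠ g i → c' i = c i) :
    ∃ s', TransGen (fun a b => Observes P g v c a ∧ (projection P G g).Step a b) s s' ∧
      Observes P g w c' s' := by
  have hvw : v ≠ w := fun h => G.irrefl w (h ▸ he)
  -- An observed sender must fire at once, as prescribed by `c'`; an unobserved one first runs
  -- internally until it can send. The receiver is treated alike.
  obtain ⟨q₁, q₂, hq, hqv, hsnd, hq₂⟩ : ∃ q₁ q₂, ReflTransGen P.IntStep (s v) q₁ ∧
      (v ∈ Set.range g → q₁ = s v) ∧ P.trans q₁ .snd q₂ ∧ ∀ i, v = g i → c' i = q₂ := by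
    by_cases hr : v ∈ Set.range g
    · obtain ⟨i, rfl⟩ := hr
      exact ⟨_, c' i, .refl, fun _ => rfl, hs.2 i ▸ hv i rfl, fun i' h => by rw [hg h]⟩
    · obtain ⟨q₁, q₂, h1, h2⟩ := P.exists_snd ((hs.1 v).2 rfl)
      exact ⟨q₁, q₂, h1, fun h => absurd h hr, h2, fun i h => absurd ⟨i, h.symm⟩ hr⟩
  obtain ⟨r₁, r₂, hr, hrw, hrcv, hr₂⟩ : ∃ r₁ r₂, ReflTransGen P.IntStep (s w) r₁ ∧
      (w ∈ Set.range g → r₁ = s w) ∧ P.trans r₁ .rcv r₂ ∧ ∀ i, w = g i → c' i = r₂ := by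
    by_cases hr : w ∈ Set.range g
    · obtain ⟨i, rfl⟩ := hr
      exact ⟨_, c' i, .refl, fun _ => rfl, hs.2 i ▸ hw i rfl, fun i' h => by rw [hg h]⟩
    · obtain ⟨r₁, r₂, h1, h2⟩ := P.exists_rcv fun h => hvw ((hs.1 w).1 h).symm
      exact ⟨r₁, r₂, h1, fun h => absurd h hr, h2, fun i h => absurd ⟨i, h.symm⟩ hr⟩
  obtain ⟨w1, o1⟩ := hs.intSteps hq hqv
  have hsw : update s v q₁ w = s w := update_of_ne hvw.symm _ _
  obtain ⟨w2, o2⟩ := o1.intSteps (u := w) (q := r₁) (by rwa [hsw]) (by rwa [hsw])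
  have hm : TokMove P v w (update (update s v q₁) w r₁) (update (update s v q₂) w r₂) := by
    refine ⟨he, ?_, ?_, fun u h1 h2 => ?_⟩
    · simpa [update_of_ne hvw] using hsnd
    · simpa using hrcv
    · simp [update_of_ne h1, update_of_ne h2]
  refine ⟨update (update s v q₂) w r₂,
    .tail' (w1.trans w2) ⟨o2, step_projection_iff.2 (Or.inr ⟨v, w, hm⟩)⟩,
    hm.hasTokenAt o2.1, fun i => ?_⟩
  by_cases hiw : w = g i
  · rw [← hiw, update_self, hr₂ i hiw]
  · rw [update_of_ne (Ne.symm hiw)]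
    by_cases hiv : v = g i
    · rw [← hiv, update_self, hq₂ i hiv]
    · rw [update_of_ne (Ne.symm hiv), hne i hiv hiw, hs.2 i]

end Systems

-- Replaying runs on the other topology

section Simulation

variable {AP Q I : Type*} {P : Template AP Q I} {G G' : Topology} {k : ℕ}
  {g : Fin k → G.Vertex} {g' : Fin k → G'.Vertex}

/-- Two global states are related if the token is at vertices of the same type, and the observed
processes are in the same local states. -/
def SystemRel (P : Template AP Q I) (g : Fin k → G.Vertex) (g' : Fin k → G'.Vertex) (d : ℕ)
    (s : G.Vertex → Q) (s' : G'.Vertex → Q) : Prop :=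
  ∃ v v', HasTokenAt P s v ∧ Observes P g' v' (fun i => s (g i)) s' ∧
    (graphLTS G g).stateType d v = (graphLTS G' g').stateType d v'

theorem SystemRel.symm {d : ℕ} {s : G.Vertex → Q} {s' : G'.Vertex → Q}
    (h : SystemRel P g g' d s s') : SystemRel P g' g d s' s := by
  obtain ⟨v, v', h1, h2, h3⟩ := h
  exact ⟨v', v, h2.1, ⟨h1, fun i => (h2.2 i).symm⟩, h3.symm⟩

theorem eq_iff_of_stateType_eq {d : ℕ} {v : G.Vertex} {v' : G'.Vertex}
    (h : (graphLTS G g).stateType d v = (graphLTS G' g').stateType d v') (i : Fin k) :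
    v = g i ↔ v' = g' i :=
  Set.ext_iff.1 (label_eq_of_stateType_eq h) i

/-- Adjacent vertices of the same type are not observed. -/
theorem ne_of_edge_of_stateType_eq {d : ℕ} {v w : G.Vertex} (he : G.edge v w)
    (h : (graphLTS G g).stateType d v = (graphLTS G g).stateType d w) (i : Fin k) :
    v ≠ g i ∧ w ≠ g i := by
  have hi := eq_iff_of_stateType_eq h i
  have : v ≠ g i := fun hv => G.irrefl v (by
    have := hi.1 hv
    rw [← hv] at this
    rwa [this] at he)
  exact ⟨this, fun hw => this (hi.2 hw)⟩

theorem exists_lt_succ_of_unbounded {f : ℕ → ℕ} (hf : ∀ n, ∃ i, n ≤ f i) (n : ℕ) :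
    ∃ i, n ≤ i ∧ f i < f (i + 1) := by
  by_contra hcon
  push Not at hcon
  have hanti : ∀ i, n ≤ i → f i ≤ f n := fun i hi => by
    induction i, hi using Nat.le_induction with
    | base => exact le_rfl
    | succ i hi ih => exact (hcon i hi).trans ih
  obtain ⟨i, hi⟩ := hf ((∑ r ∈ Finset.range (n + 1), f r) + 1)
  have hle : ∀ i ≤ n, f i ≤ ∑ r ∈ Finset.range (n + 1), f r := fun i hi =>
    Finset.single_le_sum (f := f) (fun _ _ => Nat.zero_le _) (Finset.mem_range.2 (by omega))
  rcases le_total i n with h | h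
  · have := hle i h; omega
  · have := hanti i h; have := hle n le_rfl; omega

theorem SystemRel.exists_path (hg : Injective g) (hg' : Injective g') {d : ℕ}
    {s : G.Vertex → Q} {s' : G'.Vertex → Q} (hs : SystemRel P g g' (d + 1) s s')
    {x : ℕ → G.Vertex → Q} (hx : (projection P G g).IsInfPath x) (hx0 : x 0 = s) :
    ∃ y, (projection P G' g').IsInfPath y ∧ y 0 = s' ∧ StutterMatch (SystemRel P g g' d) x y := by
  subst hx0
  obtain ⟨v, v', hv, hv', htype⟩ := hs
  obtain ⟨p, h, hp0, hh0, hp, hhunb, htok, hmove⟩ := exists_token_path hx hv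
  obtain ⟨p', hp', hp'0, j, hj0, hjmono, hjunb, hjR, hjblock⟩ :=
    exists_stutterMatch_of_stateType_eq htype hp hp0
  have hedge' : ∀ m, G'.edge (p' m) (p' (m + 1)) := fun m => by
    obtain ⟨a, ha⟩ := hp'
    exact ha m
  let c : ℕ → Fin k → Q := fun t i => x t (g i)
  have hrel : ∀ t m, (graphLTS G g).stateType d (p (h t)) = (graphLTS G' g').stateType d (p' m) →
      ∀ a, Observes P g' (p' m) (c t) a → SystemRel P g g' d (x t) a :=
    fun t m hm a ha => ⟨p (h t), p' m, htok t, ha, hm⟩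
  have hhmono : Monotone h := monotone_nat_of_le_succ fun t => by
    rcases hmove t with h | h <;> omega
  suffices hex : ∃ y : ℕ → G'.Vertex → Q, (∀ m, (projection P G' g').Step (y m) (y (m + 1))) ∧
      y 0 = s' ∧ StutterMatch (SystemRel P g g' d) x y by
    obtain ⟨y, h1, h2, h3⟩ := hex
    exact ⟨y, LTS.isInfPath_iff.2 h1, h2, h3⟩
  refine exists_stutterMatch_of_invariant (T := (projection P G' g').Step)
    -- After `h t` token moves on `G`, the token on `G'` stands at the start of block `h t` of the
    -- matching path. Progress means that this position advances.
    (Inv := fun t a => Observes P g' (p' (j (h t))) (c t) a)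
    (prog := fun t => j (h t) < j (h (t + 1))) ?_ (fun t a ha => hrel t _ (hjR _) a ha) ?_ ?_
  · rw [hh0, hj0, hp'0]; exact hv'
  · refine exists_lt_succ_of_unbounded (f := fun t => j (h t)) fun n => ?_
    obtain ⟨i, hi⟩ := hjunb n
    obtain ⟨t, ht⟩ := hhunb i
    exact ⟨t, hi.trans (hjmono ht)⟩
  intro t a ha
  rcases hmove t with ⟨hht, u, hu, hne⟩ | ⟨hht, he, hsnd, hrcv, hne⟩
  · rw [hht]
    by_cases hr : u ∈ Set.range g
    · obtain ⟨i, rfl⟩ := hr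
      have hstep := ha.intStep (u := g' i) (q := x (t + 1) (g i)) (by rw [ha.2 i]; exact hu)
      refine ⟨update a (g' i) (x (t + 1) (g i)), ⟨hstep.2, fun i' => ?_⟩,
        .single ⟨hrel t _ (hjR _) a ha, hstep.1⟩, fun h => absurd h (lt_irrefl _)⟩
      by_cases hi : i' = i
      · subst hi; rw [update_self]
      · rw [update_of_ne (hg'.ne hi), ha.2 i']
        exact hne _ (hg.ne hi)
    -- An internal move of an unobserved process is simply omitted.
    · refine ⟨a, ⟨ha.1, fun i => ?_⟩, .refl, fun h => absurd h (lt_irrefl _)⟩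
      rw [ha.2 i]
      exact hne _ fun h => hr ⟨i, h⟩
  · rw [hht]
    set i := h t with hi
    have hc : ∀ b, p i ≠ g b → p (i + 1) ≠ g b → c (t + 1) b = c t b := fun b h1 h2 =>
      hne _ (Ne.symm h1) (Ne.symm h2)
    -- If block `i` is empty, both ends of the edge have the type of one vertex of `G'`, so sender
    -- and receiver are unobserved and nothing need be replayed.
    rcases (hjmono (show i ≤ i + 1 by omega)).eq_or_lt with heq | hlt
    · have htt : (graphLTS G g).stateType d (p i) = (graphLTS G g).stateType d (p (i + 1)) := by
        rw [hjR i, hjR (i + 1), ← heq]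
      refine ⟨a, ?_, .refl, fun h => absurd heq h.ne⟩
      rw [← heq]
      refine ⟨ha.1, fun b => ?_⟩
      obtain ⟨h1, h2⟩ := ne_of_edge_of_stateType_eq he htt b
      rw [ha.2 b, hc b h1 h2]
    · have hlift : ∀ m, j i ≤ m → m < j (i + 1) → ∀ {a b},
          TransGen (fun a b => Observes P g' (p' m) (c t) a ∧ (projection P G' g').Step a b) a b →
          TransGen (fun a b => SystemRel P g g' d (x t) a ∧ (projection P G' g').Step a b) a b :=
        fun m h1 h2 a b hab => TransGen.mono (fun a b hab =>
           ⟨hrel t m (hjblock i m h1 h2) a hab.1, hab.2⟩) _ _ hab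
      -- Within the block all vertices have the type of `p i`, so the token passes between
      -- unobserved processes and the observed states stay fixed.
      have hwalk : ∀ r, j i + r < j (i + 1) → ∃ b, ReflTransGen
          (fun a b => SystemRel P g g' d (x t) a ∧ (projection P G' g').Step a b) a b ∧
          Observes P g' (p' (j i + r)) (c t) b := by
        intro r
        induction r with
        | zero => exact fun _ => ⟨a, .refl, ha⟩
        | succ r ih =>
          intro hr
          obtain ⟨b, hab, hb⟩ := ih (by omega)
          have htt := (hjblock i (j i + r) (by omega) (by omega)).symm.trans
            (hjblock i (j i + r + 1) (by omega) (by omega))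
          have hhid := ne_of_edge_of_stateType_eq (hedge' (j i + r)) htt
          obtain ⟨b', hbb', hb'⟩ := hb.exists_tokMove hg' (c' := c t) (hedge' (j i + r))
            (fun l hl => absurd hl (hhid l).1) (fun l hl => absurd hl (hhid l).2)
            (fun _ _ _ => rfl)
          exact ⟨b', hab.trans (hlift _ (by omega) (by omega) hbb').to_reflTransGen, hb'⟩
      -- The walk stops at the last vertex of the block. The edge leaving it has ends of the types
      -- of `p i` and `p (i + 1)`, so exactly this move replays the observed transitions.
      obtain ⟨b, hab, hb⟩ := hwalk (j (i + 1) - 1 - j i) (by omega)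
      have hm : j i + (j (i + 1) - 1 - j i) = j (i + 1) - 1 := by omega
      rw [hm] at hb
      have hlast := hedge' (j (i + 1) - 1)
      rw [Nat.sub_add_cancel (by omega)] at hlast
      have e1 := eq_iff_of_stateType_eq (hjblock i (j (i + 1) - 1) (by omega) (by omega))
      have e2 := eq_iff_of_stateType_eq (hjR (i + 1))
      obtain ⟨b', hbb', hb'⟩ := hb.exists_tokMove hg' (c' := c (t + 1)) hlast
        (fun l hl => by
          have := (e1 l).2 hl
          simp only [c, ← this]
          exact hsnd)
        (fun l hl => by
          have := (e2 l).2 hl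
          simp only [c, ← this]
          exact hrcv)
        (fun l h1 h2 => hc l (fun h => h1 ((e1 l).1 h)) (fun h => h2 ((e2 l).1 h)))
      have := TransGen.trans_right hab (hlift _ (by omega) (by omega) hbb')
      exact ⟨b', hb', this.to_reflTransGen, fun _ => this⟩

theorem stutterBisim_projection (hg : Injective g) (hg' : Injective g') :
    StutterBisim (projection P G g) (projection P G' g') (SystemRel P g g') where
  label_eq := by
    rintro d s s' ⟨v, v', -, ho, -⟩
    ext ⟨a, i⟩
    show a ∈ P.label (s (g i)) ↔ a ∈ P.label (s' (g' i))
    rw [ho.2 i]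
  forth hR _ hπ h0 := hR.exists_path hg hg' hπ h0
  back hR _ hπ h0 := by
    obtain ⟨π, h1, h2, j, h3, h4, h5, h6, h7⟩ := hR.symm.exists_path hg' hg hπ h0
    exact ⟨π, h1, h2, j, h3, h4, h5, fun i => (h6 i).symm, fun i m hi hm => (h7 i m hi hm).symm⟩

open Classical in
/-- The token-passing system has exactly one initial state. -/
theorem mem_init_projection_iff {s : G.Vertex → Q} :
    s ∈ (projection P G g).init ↔
      s = fun v => if v = G.start then P.initTok else P.initNoTok := by
  constructor
  · rintro ⟨h1, h2⟩
    funext v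
    have hv := h1 v
    rw [P.init_eq] at hv
    rcases hv with hv | hv
    · rw [if_pos ((h2 v).1 (hv ▸ P.initTok_mem)), hv]
    · have hv : s v = P.initNoTok := hv
      rw [if_neg fun h => P.initNoTok_notMem (hv ▸ (h2 v).2 h), hv]
  · rintro rfl
    refine ⟨fun v => ?_, fun v => ?_⟩
    · rw [P.init_eq]
      show ite _ _ _ ∈ _
      split_ifs
      · exact Or.inl rfl
      · exact Or.inr rfl
    · by_cases h : v = G.start
      · simp [h, P.initTok_mem]
      · simp [h, P.initNoTok_notMem]

end Simulation

end TokenPassing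

theorem mainTheorem2 (d k : ℕ) (G G' : Topology)
    (g : Fin k → G.Vertex) (hg : Function.Injective g)
    (g' : Fin k → G'.Vertex) (hg' : Function.Injective g')
    (hGG' : DepthEquiv d (graphLTS G g) (graphLTS G' g'))
    {AP Q I : Type*} [Finite I] [Nonempty I] (P : Template AP Q I) :
    DepthEquiv d (projection P G g) (projection P G' g') := by
  classical
  -- Each graph has a single initial vertex, so equivalence of the graphs is equality of the types
  -- of the two initial vertices.
  have htype : (graphLTS G g).stateType d G.start = (graphLTS G' g').stateType d G'.start := by
    refine stateType_eq_iff.2 fun φ hφ => ?_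
    simpa [LTS.Models, graphLTS] using hGG' φ hφ
  have hrel : ∀ s ∈ (projection P G g).init, ∀ s' ∈ (projection P G' g').init,
      SystemRel P g g' d s s' := by
    intro s hs s' hs'
    refine ⟨G.start, G'.start, hs.2, ⟨hs'.2, fun i => ?_⟩, htype⟩
    rw [mem_init_projection_iff.1 hs, mem_init_projection_iff.1 hs']
    have := eq_iff_of_stateType_eq htype i
    simp only [eq_comm (a := g' i), eq_comm (a := g i), this]
  intro φ hφ
  have key := fun s hs s' hs' =>
    φ.sat_iff_of_bisim (stutterBisim_projection (P := P) hg hg') hφ (hrel s hs s' hs')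
  exact ⟨fun h s' hs' => (key _ (mem_init_projection_iff.2 rfl) s' hs').1
      (h _ (mem_init_projection_iff.2 rfl)),
    fun h s hs => (key s hs _ (mem_init_projection_iff.2 rfl)).2
      (h _ (mem_init_projection_iff.2 rfl))⟩
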